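/- Let $F$ be a field with an automorphism $\sigma$ of order $2$, and let $F_0=\{a\in F : \sigma(a)=a\}$ be its fixed field. Suppose that $F_0$ has property FE, that is, $F_0$ is perfect, its characteristic is different from $2$, and for every integer $n\ge 1$ it has only finitely many field extensions of degree $n$ inside an algebraic closure (equivalently, up to isomorphism over $F_0$). Let $V$ be a finite-dimensional vector space over $F$ and let $B\colon V\times V\to F$ be a non-degenerate hermitian form, that is, $B$ is linear in the first variable and $B(u,v)=\sigma(B(v,u))$ for all $u,v\in V$. Let $U(V,B)=\{g\in GL(V) : B(gu,gv)=B(u,v)\text{ for all }u,v\in V\}$ be its unitary group. Call two elements $x,y$ of a group $G$ $z$-equivalent if their centralizers are conjugate in $G$, i.e. $\mathcal Z_G(y)=g\,\mathcal Z_G(x)\,g^{-1}$ for some $g\in G$; the equivalence classes are called $z$-classes. Then the number of $z$-classes in $U(V,B)$ is finite. -/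

import Mathlib

/-- Two elements of a group are `z`-equivalent if their centralizers are conjugate:
`Z_G(y) = g Z_G(x) g⁻¹` for some `g`. -/
def ZEquiv {G : Type*} [Group G] (x y : G) : Prop :=
  ∃ g : G, Subgroup.centralizer {y} =
    (Subgroup.centralizer {x}).map (MulAut.conj g).toMonoidHom

theorem ZEquiv.equivalence (G : Type*) [Group G] :
    Equivalence (ZEquiv : G → G → Prop) where
  refl x := ⟨1, by ext z; simp⟩
  symm := by
    rintro x y ⟨g, h⟩
    refine ⟨g⁻¹, ?_⟩
    rw [h, Subgroup.map_map]
    ext z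
    simp [mul_assoc]
  trans := by
    rintro x y z ⟨g, h⟩ ⟨k, h'⟩
    refine ⟨k * g, ?_⟩
    rw [h', h, Subgroup.map_map]
    congr 1
    ext w
    simp [mul_assoc]

/-- `z`-equivalence as a setoid on the group. -/
def zSetoid (G : Type*) [Group G] : Setoid G := ⟨ZEquiv, ZEquiv.equivalence G⟩

/-- The type of `z`-classes of a group. -/
def ZClass (G : Type*) [Group G] : Type _ := Quotient (zSetoid G)

/-- Property FE: the field is perfect, of characteristic different from two, and for every
`n ≥ 1` it has only finitely many extensions of degree `n` inside its algebraic closure.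
(An isomorphism class of degree `n` extensions has at least one and at most `n` members inside the
algebraic closure, so counting extensions up to isomorphism gives the same property.
`Module.finrank` is `0` for infinite extensions, which are excluded by `0 < n`.) -/
structure PropertyFE (K : Type*) [Field K] : Prop where
  perfect : PerfectField K
  char_ne_two : ringChar K ≠ 2
  finite_extensions : ∀ n : ℕ, 0 < n →
    {L : IntermediateField K (AlgebraicClosure K) | Module.finrank K L = n}.Finite

/-- The subfield of elements fixed by a field automorphism. -/
def fixedSubfield {F : Type*} [Field F] (σ : F ≃+* F) : Subfield F :=
  RingHom.eqLocusField (σ : F →+* F) (RingHom.id F)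

theorem mem_fixedSubfield {F : Type*} [Field F] (σ : F ≃+* F) (a : F) :
    a ∈ fixedSubfield σ ↔ σ a = a := Iff.rfl

/-- A form that is linear in the first and `σ`-semilinear in the second variable is hermitian if
`B u v = σ (B v u)`. -/
def IsHermitianForm {F V : Type*} [Field F] [AddCommGroup V] [Module F V] (σ : F ≃+* F)
    (B : V →ₗ[F] V →ₛₗ[(σ : F →+* F)] F) : Prop :=
  ∀ u v : V, B u v = σ (B v u)

/-- The unitary group `U(V, B)` of all linear automorphisms that preserve the form `B`. -/
def unitaryGroupOf {F V : Type*} [Field F] [AddCommGroup V] [Module F V] {σ : F ≃+* F}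
    (B : V →ₗ[F] V →ₛₗ[(σ : F →+* F)] F) : Subgroup (V ≃ₗ[F] V) where
  carrier := {g | ∀ u v : V, B (g u) (g v) = B u v}
  one_mem' := fun _ _ => rfl
  mul_mem' := by
    intro g h hg hh u v
    rw [LinearEquiv.mul_apply, LinearEquiv.mul_apply, hg, hh]
  inv_mem' := by
    intro g hg u v
    have h := hg (g⁻¹ u) (g⁻¹ v)
    rw [← LinearEquiv.mul_apply, ← LinearEquiv.mul_apply, mul_inv_cancel] at h
    exact h.symm

/-! Write `K` for the fixed field. If `K` is finite, so is the group. If `K` is infinite, a Cayley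
transform replaces an isometry `g` by a self-adjoint endomorphism `h` that commutes with the same
isometries (`exists_selfAdjoint_commute_iff`). Self-adjointness survives polynomials over `K`, so
`h` may be replaced by any generator of the algebra `K[h]` without changing the centralizer of `g`.

This freedom bounds the annihilating polynomials. Over a perfect field, `K[X]/(p ^ k)` depends only
on the field `K[X]/(p)` and on `k`, and FE leaves finitely many such fields in each degree. Hence
some generator of `K[h]` is annihilated by a member of a finite list
(`finitely_many_monic_classes`).

It remains to fix `m` and classify the self-adjoint `h` with `m(h) = 0` up to isometry
(`finitely_many_selfAdjoint_classes`). The space is an orthogonal sum of cyclic subspaces generated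
by primary vectors `v`, and the form on each is determined by the functional `f ↦ B (f(h) v) v` with
values in `K`. Such functionals on `K[X]/(p ^ (k + 1))` differ by units, and replacing `v` by `u(h)
v` changes the unit by a square. Units modulo squares are finite in number: by a Hensel argument
this is a question about the residue field, whose quadratic extensions FE bounds. An isometry that
intertwines `h` and `h'` conjugates the centralizers. -/

open Polynomial

/-! ### Relations with finitely many classes -/

/-- Finitely many values of an invariant suffice to decide the relation `R` on `s`. -/
def FinitelyManyClasses {α : Type*} (s : Set α) (R : α → α → Prop) : Prop :=
  ∃ (ι : Type) (_ : Finite ι) (f : α → ι), ∀ x ∈ s, ∀ y ∈ s, f x = f y → R x y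

namespace FinitelyManyClasses

variable {α β : Type*} {s : Set α} {R : α → α → Prop}

/-- Passing to `Fin n` brings the index into `Type`, whatever the universe of `β`. -/
theorem of_finite [Finite β] (f : α → β)
    (h : ∀ x ∈ s, ∀ y ∈ s, f x = f y → R x y) : FinitelyManyClasses s R := by
  obtain ⟨n, ⟨e⟩⟩ := Finite.exists_equiv_fin β
  exact ⟨Fin n, inferInstance, e ∘ f, fun x hx y hy hxy => h x hx y hy (e.injective hxy)⟩

theorem of_image_finite (f : α → β) (hf : (f '' s).Finite)
    (h : ∀ x ∈ s, ∀ y ∈ s, f x = f y → R x y) : FinitelyManyClasses s R := by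
  classical
  have := hf.to_subtype
  refine of_finite (β := Option (f '' s))
    (fun x => if hx : x ∈ s then some ⟨f x, x, hx, rfl⟩ else none) ?_
  intro x hx y hy hxy
  simp only [hx, hy, dif_pos, Option.some.injEq] at hxy
  exact h x hx y hy (congrArg Subtype.val hxy)

theorem of_data [Finite β] (D : α → β → Prop) (hD : ∀ x ∈ s, ∃ b, D x b)
    (h : ∀ x y b, D x b → D y b → R x y) : FinitelyManyClasses s R := by
  classical
  refine of_finite (β := Option β) (fun x => if hx : x ∈ s then some (hD x hx).choose else none) ?_
  intro x hx y hy hxy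
  simp only [hx, hy, dif_pos, Option.some.injEq] at hxy
  exact h x y _ (hD x hx).choose_spec (hxy ▸ (hD y hy).choose_spec)

theorem exists_representatives (h : FinitelyManyClasses s R) :
    ∃ T : Set α, T.Finite ∧ T ⊆ s ∧ ∀ x ∈ s, ∃ t ∈ T, R x t := by
  classical
  obtain ⟨ι, _, f, hf⟩ := h
  have H : ∀ i : f '' s, ∃ x ∈ s, f x = i := fun i => i.2
  choose g hg hfg using H
  refine ⟨Set.range g, Set.finite_range g, by rintro _ ⟨i, rfl⟩; exact hg i, fun x hx => ?_⟩
  exact ⟨g ⟨f x, x, hx, rfl⟩, ⟨_, rfl⟩, hf x hx _ (hg _) (hfg ⟨f x, x, hx, rfl⟩).symm⟩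

end FinitelyManyClasses

/-! ### Consequences of FE: square classes and residue fields -/

section FieldExtensions

variable {K : Type*} [Field K]

theorem PropertyFE.finite_bounded_degree (hK : PropertyFE K) (n : ℕ) :
    {L : IntermediateField K (AlgebraicClosure K) |
      0 < Module.finrank K L ∧ Module.finrank K L ≤ n}.Finite := by
  refine ((Set.finite_Icc 1 n).biUnion
    (fun i hi => hK.finite_extensions i (Set.mem_Icc.1 hi).1)).subset ?_
  rintro L ⟨h1, h2⟩
  exact Set.mem_biUnion (Set.mem_Icc.2 ⟨h1, h2⟩) rfl

theorem PropertyFE.two_ne_zero (hK : PropertyFE K) : (2 : K) ≠ 0 :=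
  Ring.two_ne_zero hK.char_ne_two

/-- The easy part of Kummer theory for exponent two. If `x ∉ L`, write `y = a + b * x`; since `y ^ 2
∈ L` and `2 ≠ 0`, the cross term forces `a * b = 0`, and `b = 0` would put `y`, hence `x`, into `L`.
-/
theorem exists_eq_mul_sq_of_adjoin_sqrt_eq {E : Type*} [Field E] [Algebra K E]
    (h2 : (2 : K) ≠ 0) (L : IntermediateField K E) {x y : E} (hx : x ≠ 0) (hy : y ≠ 0)
    (hx2 : x ^ 2 ∈ L) (hy2 : y ^ 2 ∈ L)
    (h : IntermediateField.adjoin L {x} = IntermediateField.adjoin L {y}) :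
    ∃ d ∈ L, x ^ 2 * d ^ 2 = y ^ 2 := by
  by_cases hxL : x ∈ L
  · have h1 : IntermediateField.adjoin L {x} = ⊥ := by
      rw [IntermediateField.adjoin_simple_eq_bot_iff, IntermediateField.mem_bot]
      exact ⟨⟨x, hxL⟩, rfl⟩
    rw [h1] at h
    have h3 := IntermediateField.adjoin_simple_eq_bot_iff.1 h.symm
    obtain ⟨z, hz⟩ := IntermediateField.mem_bot.1 h3
    have hyL : y ∈ L := hz ▸ z.2
    exact ⟨y / x, L.div_mem hyL hxL, by field_simp⟩
  · have hint : IsIntegral L x := by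
      refine ⟨X ^ 2 - C ⟨x ^ 2, hx2⟩, monic_X_pow_sub_C _ (by norm_num), ?_⟩
      simp [eval₂_sub, IntermediateField.algebraMap_apply]
    have hy' : y ∈ IntermediateField.adjoin L {x} := by
      rw [h]; exact IntermediateField.mem_adjoin_simple_self L y
    have hmem : ∃ a ∈ L, ∃ b ∈ L, y = a + b * x := by
      rw [← IntermediateField.mem_toSubalgebra,
        IntermediateField.adjoin_simple_toSubalgebra_of_isAlgebraic hint.isAlgebraic] at hy'
      refine Algebra.adjoin_induction (p := fun y _ => ∃ a ∈ L, ∃ b ∈ L, y = a + b * x)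
        ?_ ?_ ?_ ?_ hy'
      · rintro z rfl
        exact ⟨0, L.zero_mem, 1, L.one_mem, by ring⟩
      · intro r
        exact ⟨r, r.2, 0, L.zero_mem, by simp [IntermediateField.algebraMap_apply]⟩
      · rintro _ _ _ _ ⟨a, ha, b, hb, rfl⟩ ⟨a', ha', b', hb', rfl⟩
        exact ⟨a + a', L.add_mem ha ha', b + b', L.add_mem hb hb', by ring⟩
      · rintro _ _ _ _ ⟨a, ha, b, hb, rfl⟩ ⟨a', ha', b', hb', rfl⟩
        exact ⟨a * a' + b * b' * x ^ 2, L.add_mem (L.mul_mem ha ha')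
          (L.mul_mem (L.mul_mem hb hb') hx2), a * b' + a' * b,
          L.add_mem (L.mul_mem ha hb') (L.mul_mem ha' hb), by ring⟩
    obtain ⟨a, ha, b, hb, rfl⟩ := hmem
    have h2E : (2 : E) ≠ 0 := by
      have := (map_ne_zero (algebraMap K E)).2 h2
      rwa [map_ofNat] at this
    have h2L : (2 : E) ∈ L := by
      have := L.algebraMap_mem 2
      rwa [map_ofNat] at this
    have hab : a * b = 0 := by
      by_contra hab
      apply hxL
      have : x = ((a + b * x) ^ 2 - a ^ 2 - b ^ 2 * x ^ 2) / (2 * (a * b)) := by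
        rw [eq_div_iff (mul_ne_zero h2E hab)]; ring
      rw [this]
      exact L.div_mem (L.sub_mem (L.sub_mem hy2 (pow_mem ha 2))
        (L.mul_mem (pow_mem hb 2) hx2)) (L.mul_mem h2L (L.mul_mem ha hb))
    rcases mul_eq_zero.1 hab with rfl | rfl
    · exact ⟨b, hb, by ring⟩
    · exfalso
      apply hxL
      have h3 : IntermediateField.adjoin L {a + 0 * x} = ⊥ := by
        rw [IntermediateField.adjoin_simple_eq_bot_iff, IntermediateField.mem_bot]
        exact ⟨⟨a, ha⟩, by simp [IntermediateField.algebraMap_apply]⟩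
      rw [h3] at h
      obtain ⟨z, hz⟩ := IntermediateField.mem_bot.1
        (IntermediateField.adjoin_simple_eq_bot_iff.1 h)
      exact hz ▸ z.2

theorem exists_root_algebraicClosure {p : K[X]} (hp : Irreducible p) :
    ∃ θ : AlgebraicClosure K, aeval θ p = 0 :=
  IsAlgClosed.exists_aeval_eq_zero _ p hp.degree_pos.ne'

theorem aeval_eq_zero_iff_dvd {p : K[X]} (hp : Irreducible p) {θ : AlgebraicClosure K}
    (hθ : aeval θ p = 0) (f : K[X]) : aeval θ f = 0 ↔ p ∣ f := by
  constructor
  · intro hf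
    have hint := Algebra.IsIntegral.isIntegral (R := K) θ
    exact ((minpoly.irreducible hint).dvd_symm hp (minpoly.dvd K θ hθ)).trans (minpoly.dvd K θ hf)
  · rintro ⟨c, rfl⟩
    simp [hθ]

theorem mem_adjoin_simple_iff_aeval (θ x : AlgebraicClosure K) :
    x ∈ IntermediateField.adjoin K {θ} ↔ ∃ f : K[X], aeval θ f = x := by
  rw [← IntermediateField.mem_toSubalgebra,
    IntermediateField.adjoin_simple_toSubalgebra_of_isAlgebraic (Algebra.IsAlgebraic.isAlgebraic θ),
    Algebra.adjoin_singleton_eq_range_aeval]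
  rfl

/-- Modulo an irreducible polynomial there are finitely many square classes. -/
theorem PropertyFE.finitely_many_square_classes (hK : PropertyFE K) {p : K[X]}
    (hp : Irreducible p) :
    ∃ T : Set K[X], T.Finite ∧ (∀ t ∈ T, ¬ p ∣ t) ∧
      ∀ c, ¬ p ∣ c → ∃ t ∈ T, ∃ d, p ∣ c * d ^ 2 - t := by
  obtain ⟨θ, hθ⟩ := exists_root_algebraicClosure hp
  let L := IntermediateField.adjoin K {θ}
  have hLfin : FiniteDimensional K L :=
    IntermediateField.adjoin.finiteDimensional (Algebra.IsIntegral.isIntegral θ)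
  have hroot : ∀ c : K[X], ∃ y : AlgebraicClosure K, y ^ 2 = aeval θ c := fun c =>
    IsAlgClosed.exists_pow_nat_eq _ (by norm_num)
  choose y hy using hroot
  have hyL : ∀ c, y c ^ 2 ∈ L := fun c => by
    rw [hy]; exact (mem_adjoin_simple_iff_aeval _ _).2 ⟨c, rfl⟩
  have key : FinitelyManyClasses {c : K[X] | ¬ p ∣ c} (fun c t => ∃ d, p ∣ c * d ^ 2 - t) := by
    -- The invariant of `c` is the field `L(√c)`, viewed over `K`; its degree is at most `2 * [L :
    -- K]`.
    refine FinitelyManyClasses.of_image_finite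
      (fun c => (IntermediateField.adjoin L {y c}).restrictScalars K)
      ((hK.finite_bounded_degree (Module.finrank K L * 2)).subset ?_) ?_
    · rintro _ ⟨c, -, rfl⟩
      have hmonic : (X ^ 2 - C ⟨y c ^ 2, hyL c⟩ : L[X]).Monic :=
        monic_X_pow_sub_C _ (by norm_num)
      have hev : aeval (y c) (X ^ 2 - C ⟨y c ^ 2, hyL c⟩ : L[X]) = 0 := by
        simp [IntermediateField.algebraMap_apply]
      have hint : IsIntegral L (y c) := ⟨_, hmonic, hev⟩
      have hdeg : Module.finrank L (IntermediateField.adjoin L {y c}) ≤ 2 := by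
        rw [IntermediateField.adjoin.finrank hint]
        exact (natDegree_le_of_dvd (minpoly.dvd _ _ hev) hmonic.ne_zero).trans
          (natDegree_X_pow_sub_C).le
      have hf : FiniteDimensional L (IntermediateField.adjoin L {y c}) :=
        IntermediateField.adjoin.finiteDimensional hint
      have hmul := Module.finrank_mul_finrank K L (IntermediateField.adjoin L {y c})
      have hpos : 0 < Module.finrank L (IntermediateField.adjoin L {y c}) :=
        Module.finrank_pos
      have hpos' : 0 < Module.finrank K L := Module.finrank_pos
      change 0 < Module.finrank K (IntermediateField.adjoin L {y c}) ∧
        Module.finrank K (IntermediateField.adjoin L {y c}) ≤ _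
      rw [← hmul]
      exact ⟨Nat.mul_pos hpos' hpos, Nat.mul_le_mul_left _ hdeg⟩
    · intro c hc t ht hct
      have hne : ∀ c, ¬ p ∣ c → y c ≠ 0 := fun c hc h0 => hc <| by
        rw [← aeval_eq_zero_iff_dvd hp hθ, ← hy, h0]; simp
      obtain ⟨d, hd, hcd⟩ := exists_eq_mul_sq_of_adjoin_sqrt_eq hK.two_ne_zero L (hne c hc)
        (hne t ht) (hyL c) (hyL t) (IntermediateField.restrictScalars_injective K hct)
      obtain ⟨f, rfl⟩ := (mem_adjoin_simple_iff_aeval _ _).1 hd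
      refine ⟨f, (aeval_eq_zero_iff_dvd hp hθ _).1 ?_⟩
      rw [hy, hy] at hcd
      simp [hcd]
  obtain ⟨T, hT, hTs, hTr⟩ := key.exists_representatives
  exact ⟨T, hT, hTs, hTr⟩

/-- There are finitely many irreducible polynomials of given degree up to substitutions. -/
theorem PropertyFE.finitely_many_irreducible_classes (hK : PropertyFE K) (d : ℕ) :
    FinitelyManyClasses {p : K[X] | Irreducible p ∧ p.natDegree = d}
      (fun p q => ∃ r : K[X], p ∣ q.comp r) := by
  classical
  have H : ∀ p : K[X], ∃ θ : AlgebraicClosure K, Irreducible p → aeval θ p = 0 := fun p => by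
    by_cases hp : Irreducible p
    · obtain ⟨θ, h⟩ := exists_root_algebraicClosure hp
      exact ⟨θ, fun _ => h⟩
    · exact ⟨0, fun h => absurd h hp⟩
  choose θ hθ using H
  refine FinitelyManyClasses.of_image_finite (fun p => IntermediateField.adjoin K {θ p})
    ((hK.finite_bounded_degree d).subset ?_) ?_
  · rintro _ ⟨p, ⟨hp, rfl⟩, rfl⟩
    have hint := Algebra.IsIntegral.isIntegral (R := K) (θ p)
    have := IntermediateField.adjoin.finiteDimensional hint
    refine ⟨Module.finrank_pos, ?_⟩
    rw [IntermediateField.adjoin.finrank hint]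
    exact natDegree_le_of_dvd (minpoly.dvd K _ (hθ p hp)) hp.ne_zero
  -- When the chosen roots generate the same field, the root of `q` is a polynomial `r` in the root
  -- of `p`.
  · rintro p ⟨hp, -⟩ q ⟨hq, -⟩ hpq
    have h1 : θ q ∈ IntermediateField.adjoin K {θ p} := by
      change IntermediateField.adjoin K {θ p} = IntermediateField.adjoin K {θ q} at hpq
      rw [hpq]; exact IntermediateField.mem_adjoin_simple_self K _
    obtain ⟨r, hr⟩ := (mem_adjoin_simple_iff_aeval _ _).1 h1
    refine ⟨r, (aeval_eq_zero_iff_dvd hp (hθ p hp) _).1 ?_⟩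
    rw [aeval_comp, hr, hθ q hq]

end FieldExtensions

/-! ### Changing the generator of `K[X]/(m)` -/

section Generators

variable {K : Type*} [Field K]

/-- The algebra `K[X]/(m)` has a generator annihilated by `q`. -/
def HasGeneratorAnnihilatedBy (m q : K[X]) : Prop :=
  ∃ r r' : K[X], m ∣ q.comp r ∧ m ∣ r'.comp r - X

theorem dvd_comp_sub_comp {m a b : K[X]} (h : m ∣ a - b) (f : K[X]) :
    m ∣ f.comp a - f.comp b := by
  have := (h.trans (sub_dvd_eval_sub a b (f.map C)))
  simpa [comp, eval₂_eq_eval_map] using this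

theorem exists_congruent_of_isCoprime {m₁ m₂ : K[X]} (h : IsCoprime m₁ m₂) (a b : K[X]) :
    ∃ c, m₁ ∣ c - a ∧ m₂ ∣ c - b := by
  obtain ⟨u, v, huv⟩ := h
  refine ⟨a * (v * m₂) + b * (u * m₁), ⟨u * (b - a), ?_⟩, ⟨v * (a - b), ?_⟩⟩
  · linear_combination a * huv
  · linear_combination b * huv

/-- The Chinese remainder theorem is used twice: modulo `m₁, m₂` to glue the generators, and modulo
`q₁, q₂` to glue the inverse substitutions. -/
theorem HasGeneratorAnnihilatedBy.mul {m₁ m₂ q₁ q₂ : K[X]}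
    (h₁ : HasGeneratorAnnihilatedBy m₁ q₁) (h₂ : HasGeneratorAnnihilatedBy m₂ q₂)
    (hm : IsCoprime m₁ m₂) (hq : IsCoprime q₁ q₂) :
    HasGeneratorAnnihilatedBy (m₁ * m₂) (q₁ * q₂) := by
  obtain ⟨r₁, r₁', h₁, h₁'⟩ := h₁
  obtain ⟨r₂, r₂', h₂, h₂'⟩ := h₂
  obtain ⟨r, hr₁, hr₂⟩ := exists_congruent_of_isCoprime hm r₁ r₂
  obtain ⟨r', ⟨c₁, hc₁⟩, ⟨c₂, hc₂⟩⟩ := exists_congruent_of_isCoprime hq r₁' r₂'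
  have aux : ∀ {m q s s' c : K[X]}, m ∣ q.comp s → m ∣ s'.comp s - X → m ∣ r - s →
      r' - s' = q * c → m ∣ q.comp r ∧ m ∣ r'.comp r - X := by
    intro m q s s' c h1 h2 h3 h4
    have h5 : m ∣ q.comp r := by
      have := dvd_add (dvd_comp_sub_comp h3 q) h1
      simpa using this
    refine ⟨h5, ?_⟩
    have h6 : r'.comp r - s'.comp r = q.comp r * c.comp r := by
      rw [← sub_comp, h4, mul_comp]
    have : r'.comp r - X = q.comp r * c.comp r + (s'.comp r - s'.comp s) + (s'.comp s - X) := by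
      rw [← h6]; ring
    rw [this]
    exact dvd_add (dvd_add (h5.mul_right _) (dvd_comp_sub_comp h3 s')) h2
  have a₁ := aux h₁ h₁' hr₁ hc₁
  have a₂ := aux h₂ h₂' hr₂ hc₂
  refine ⟨r, r', ?_, hm.mul_dvd a₁.2 a₂.2⟩
  rw [mul_comp]
  exact mul_dvd_mul a₁.1 a₂.1

/-- If `r` fails, `r + p` works: by Taylor `q(r + p) ≡ q(r) + q'(r) p` modulo `p ^ 2`, and
separability makes `q'(r)` a unit modulo `p`. -/
theorem exists_dvd_comp_not_sq_dvd_comp {p q r : K[X]} (hp : Irreducible p)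
    (hq : q.Separable) (h : p ∣ q.comp r) :
    ∃ r', p ∣ q.comp r' ∧ ¬ p ^ 2 ∣ q.comp r' := by
  by_cases h2 : p ^ 2 ∣ q.comp r
  · refine ⟨r + p, ?_, fun h3 => ?_⟩
    · have := dvd_add (dvd_comp_sub_comp (show p ∣ (r + p) - r by simp) q) h
      simpa using this
    · have h4 : p ^ 2 ∣ q.comp (r + p) - q.comp r - (derivative q).comp r * p := by
        obtain ⟨c, hc⟩ := binomExpansion (q.map C) r p
        refine ⟨c, ?_⟩
        simp only [comp, eval₂_eq_eval_map]
        rw [← derivative_map, hc]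
        ring
      have h5 : p ^ 2 ∣ (derivative q).comp r * p := by
        have := dvd_sub (dvd_sub h3 h2) h4
        simpa using this
      rw [sq] at h5
      have h6 : p ∣ (derivative q).comp r := (mul_dvd_mul_iff_right hp.ne_zero).1 h5
      obtain ⟨a, b, hab⟩ := hq
      have h7 := congrArg (fun f => f.comp r) hab
      simp only [add_comp, mul_comp, one_comp] at h7
      exact hp.not_isUnit (isUnit_of_dvd_one (h7 ▸ dvd_add (h.mul_left _) (h6.mul_left _)))
  · exact ⟨r, h, h2⟩

/-- An ideal containing `q ^ k`, with `q` irreducible, is generated by a smaller power. -/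
theorem exists_pow_eq_linear_combination {q : K[X]} (hq : Irreducible q) {k : ℕ} {f : K[X]}
    (hf : ¬ q ^ k ∣ f) : ∃ j < k, ∃ a b, q ^ j = f * a + q ^ k * b := by
  classical
  obtain ⟨j, hj, hass⟩ :=
    (dvd_prime_pow hq.prime k).1 (EuclideanDomain.gcd_dvd_right f (q ^ k))
  have hjk : j ≠ k := by
    rintro rfl
    exact hf (hass.symm.dvd.trans (EuclideanDomain.gcd_dvd_left _ _))
  obtain ⟨c, hc⟩ := hass.dvd
  refine ⟨j, lt_of_le_of_ne hj hjk, EuclideanDomain.gcdA f (q ^ k) * c,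
    EuclideanDomain.gcdB f (q ^ k) * c, ?_⟩
  rw [hc, EuclideanDomain.gcd_eq_gcd_ab]
  ring

/-- Once `q(r)` is divisible by `p` exactly once, substituting `r` embeds `K[X]/(q ^ k)` into
`K[X]/(p ^ k)`. The dimensions agree, so it is onto, and a preimage of `X` is the inverse
substitution. -/
theorem hasGeneratorAnnihilatedBy_pow {p q r : K[X]} (hp : Irreducible p) (hq : Irreducible q)
    (hsep : q.Separable) (hdeg : p.natDegree = q.natDegree) (h : p ∣ q.comp r) (k : ℕ) :
    HasGeneratorAnnihilatedBy (p ^ k) (q ^ k) := by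
  obtain ⟨r, h1, h2⟩ := exists_dvd_comp_not_sq_dvd_comp hp hsep h
  have hpk : p ^ k ≠ 0 := pow_ne_zero _ hp.ne_zero
  have hqk : q ^ k ≠ 0 := pow_ne_zero _ hq.ne_zero
  have h3 : p ^ k ∣ (q ^ k).comp r := by
    rw [pow_comp]; exact pow_dvd_pow_of_dvd h1 k
  have hker : ∀ f : K[X], p ^ k ∣ f.comp r → q ^ k ∣ f := by
    intro f hf
    by_contra hqf
    obtain ⟨j, hj, a, b, hab⟩ := exists_pow_eq_linear_combination hq hqf
    obtain ⟨c, hc⟩ := h1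
    have h4 : p ^ k ∣ (q.comp r) ^ j := by
      have := congrArg (fun f => f.comp r) hab
      simp only [pow_comp, add_comp, mul_comp] at this
      rw [this]
      rw [pow_comp] at h3
      exact dvd_add (hf.mul_right _) (h3.mul_right _)
    have hpc : ¬ p ∣ c := fun hpc => h2 (by rw [hc, sq]; exact mul_dvd_mul_left p hpc)
    rw [hc, mul_pow] at h4
    have h5 : p ^ (j + 1) ∣ p ^ j * c ^ j := (pow_dvd_pow p hj).trans h4
    rw [pow_succ] at h5
    exact hpc (hp.prime.dvd_of_dvd_pow
      ((mul_dvd_mul_iff_left (pow_ne_zero j hp.ne_zero)).1 h5))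
  have hev : ∀ f : K[X], aeval (AdjoinRoot.mk (p ^ k) r) f = AdjoinRoot.mk (p ^ k) (f.comp r) := by
    intro f
    rw [comp_eq_aeval]
    exact aeval_algHom_apply (AdjoinRoot.mkₐ (p ^ k)) r f
  let φ : AdjoinRoot (q ^ k) →ₐ[K] AdjoinRoot (p ^ k) :=
    AdjoinRoot.liftAlgHom (q ^ k) (Algebra.ofId K _) (AdjoinRoot.mk (p ^ k) r)
      ((hev (q ^ k)).trans (AdjoinRoot.mk_eq_zero.2 h3))
  have hφ : ∀ f, φ (AdjoinRoot.mk _ f) = AdjoinRoot.mk _ (f.comp r) := by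
    intro f
    rw [← hev]
    exact AdjoinRoot.lift_mk ((hev (q ^ k)).trans (AdjoinRoot.mk_eq_zero.2 h3)) f
  have hinj : Function.Injective φ := by
    rw [injective_iff_map_eq_zero]
    intro x hx
    obtain ⟨f, rfl⟩ := AdjoinRoot.mk_surjective x
    rw [hφ, AdjoinRoot.mk_eq_zero] at hx
    exact AdjoinRoot.mk_eq_zero.2 (hker f hx)
  have hsurj : Function.Surjective φ := by
    have := (AdjoinRoot.powerBasis hqk).finite
    have := (AdjoinRoot.powerBasis hpk).finite
    refine (LinearMap.injective_iff_surjective_of_finrank_eq_finrank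
      (f := φ.toLinearMap) ?_).1 hinj
    rw [(AdjoinRoot.powerBasis hqk).finrank, (AdjoinRoot.powerBasis hpk).finrank,
      AdjoinRoot.powerBasis_dim, AdjoinRoot.powerBasis_dim, natDegree_pow, natDegree_pow, hdeg]
  obtain ⟨x, hx⟩ := hsurj (AdjoinRoot.mk _ X)
  obtain ⟨r', rfl⟩ := AdjoinRoot.mk_surjective x
  rw [hφ, AdjoinRoot.mk_eq_mk] at hx
  exact ⟨r, r', h3, hx⟩

theorem exists_eq_irreducible_pow_mul {m : K[X]} (hm : m.Monic) (hdeg : m.natDegree ≠ 0) :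
    ∃ (p : K[X]) (k : ℕ) (m' : K[X]), Irreducible p ∧ k ≠ 0 ∧ m'.Monic ∧ IsCoprime (p ^ k) m' ∧
      m = p ^ k * m' := by
  obtain ⟨p, hpm, hp, hpd⟩ := exists_monic_irreducible_factor m
    (fun h => hdeg (natDegree_eq_zero_of_isUnit h))
  obtain ⟨m', h1, h2⟩ :=
    (FiniteMultiplicity.of_prime_left hp.prime hm.ne_zero).exists_eq_pow_mul_and_not_dvd
  refine ⟨p, multiplicity p m, m', hp, ?_, ?_, ?_, h1⟩
  · intro h0
    rw [h0] at h1
    exact h2 (by rwa [h1, pow_zero, one_mul] at hpd)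
  · have := hpm.pow (multiplicity p m)
    exact this.of_mul_monic_left (h1 ▸ hm)
  · exact ((hp.coprime_iff_not_dvd).2 h2).pow_left

theorem PropertyFE.finitely_many_monic_classes (hK : PropertyFE K) (n : ℕ) :
    FinitelyManyClasses {m : K[X] | m.Monic ∧ m.natDegree = n} HasGeneratorAnnihilatedBy := by
  classical
  induction n using Nat.strong_induction_on with
  | _ n ih =>
  rcases Nat.eq_zero_or_pos n with rfl | hn
  · refine FinitelyManyClasses.of_finite (β := Unit) (fun _ => ()) ?_
    rintro m ⟨hm, hm0⟩ q - -
    rw [hm.natDegree_eq_zero.1 hm0]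
    exact ⟨0, 0, one_dvd _, one_dvd _⟩
  have H : ∀ m : K[X], ∃ (p : K[X]) (k : ℕ) (m' : K[X]), m.Monic → m.natDegree ≠ 0 →
      (Irreducible p ∧ k ≠ 0 ∧ m'.Monic ∧ IsCoprime (p ^ k) m' ∧ m = p ^ k * m') := by
    intro m
    by_cases h : m.Monic ∧ m.natDegree ≠ 0
    · obtain ⟨p, k, m', h'⟩ := exists_eq_irreducible_pow_mul h.1 h.2
      exact ⟨p, k, m', fun _ _ => h'⟩
    · exact ⟨0, 0, 0, fun h1 h2 => absurd ⟨h1, h2⟩ h⟩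
  choose P k M HM using H
  choose ι hι f hf using fun i : Fin n => ih i i.2
  choose κ hκ g hg using hK.finitely_many_irreducible_classes
  -- Invariants: degree and exponent of one primary factor, the class of the cofactor, and the class
  -- of the prime. `Fin.ofNat` reduces modulo `n + 1`, which loses nothing because degree and
  -- exponent are at most `n`.
  refine FinitelyManyClasses.of_finite
    (β := Fin (n + 1) × Fin (n + 1) × (∀ i, ι i) × (∀ i : Fin (n + 1), κ i))
    (fun m => (Fin.ofNat (n + 1) (P m).natDegree, Fin.ofNat (n + 1) (k m),
      fun i => f i (M m), fun i => g i (P m))) ?_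
  rintro m ⟨hm, hmn⟩ q ⟨hq, hqn⟩ hmq
  obtain ⟨h1, h2, h3, h4, h5⟩ := HM m hm (by omega)
  obtain ⟨h1', h2', h3', h4', h5'⟩ := HM q hq (by omega)
  have deg : ∀ m : K[X], m.Monic → m.natDegree = n →
      k m * (P m).natDegree + (M m).natDegree = n ∧ (P m).natDegree ≤ n ∧ k m ≤ n ∧
        (M m).natDegree < n := by
    intro m hm hmn
    obtain ⟨h1, h2, h3, h4, h5⟩ := HM m hm (by omega)
    have e : k m * (P m).natDegree + (M m).natDegree = n := by
      have := congrArg natDegree h5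
      rw [natDegree_mul (pow_ne_zero _ h1.ne_zero) h3.ne_zero, natDegree_pow] at this
      omega
    have hP := h1.natDegree_pos
    have a1 : (P m).natDegree ≤ k m * (P m).natDegree :=
      Nat.le_mul_of_pos_left _ (Nat.pos_of_ne_zero h2)
    have a2 : k m ≤ k m * (P m).natDegree := Nat.le_mul_of_pos_right _ hP
    omega
  obtain ⟨d1, d2, d3, d4⟩ := deg m hm hmn
  obtain ⟨d1', d2', d3', d4'⟩ := deg q hq hqn
  simp only [Prod.mk.injEq] at hmq
  obtain ⟨e1, e2, e3, e4⟩ := hmq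
  have e1 : (P m).natDegree = (P q).natDegree := by
    have := congrArg Fin.val e1
    simpa [Fin.ofNat, Nat.mod_eq_of_lt (Nat.lt_succ_of_le d2),
      Nat.mod_eq_of_lt (Nat.lt_succ_of_le d2')] using this
  have e2 : k m = k q := by
    have := congrArg Fin.val e2
    simpa [Fin.ofNat, Nat.mod_eq_of_lt (Nat.lt_succ_of_le d3),
      Nat.mod_eq_of_lt (Nat.lt_succ_of_le d3')] using this
  have e3 := congrFun e3 ⟨_, d4⟩
  have e4 := congrFun e4 ⟨_, Nat.lt_succ_of_le d2⟩
  obtain ⟨r, hr⟩ := hg _ (P m) ⟨h1, rfl⟩ (P q) ⟨h1', e1.symm⟩ e4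
  have hMdeg : (M q).natDegree = (M m).natDegree := by
    rw [e2, e1] at d1; omega
  have c1 := hf _ (M m) ⟨h3, rfl⟩ (M q) ⟨h3', hMdeg⟩ e3
  have := hK.perfect
  have c2 := hasGeneratorAnnihilatedBy_pow h1 h1' (PerfectField.separable_of_irreducible h1')
    e1 hr (k m)
  rw [h5, h5']
  rw [e2] at c2 h4 ⊢
  exact c2.mul c1 h4 h4'

end Generators

/-! ### Functionals on `K[X]/(p ^ (k + 1))` up to squares -/

section Functionals

variable {K : Type*} [Field K]

/-- The functional `ℓ` factors through a nondegenerate functional on `K[X]/(p ^ (k + 1))`. -/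
def IsPrimaryFunctional (p : K[X]) (k : ℕ) (ℓ : K[X] →ₗ[K] K) : Prop :=
  (∀ f, p ^ (k + 1) ∣ f → ℓ f = 0) ∧ ∃ g, ℓ (p ^ k * g) ≠ 0

/-- Every nonzero ideal of `K[X]/(p ^ (k + 1))` contains the class of `p ^ k`, and `ℓ` does not
vanish on the multiples of `p ^ k`. -/
theorem IsPrimaryFunctional.dvd_of_forall_mul_eq_zero {p : K[X]} (hp : Irreducible p) {k : ℕ}
    {ℓ : K[X] →ₗ[K] K} (hℓ : IsPrimaryFunctional p k ℓ) {f : K[X]}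
    (hf : ∀ g, ℓ (f * g) = 0) : p ^ (k + 1) ∣ f := by
  by_contra hpf
  obtain ⟨j, hj, a, b, hab⟩ := exists_pow_eq_linear_combination hp hpf
  obtain ⟨g, hg⟩ := hℓ.2
  apply hg
  have : p ^ k * g = f * (a * p ^ (k - j) * g) + p ^ (k + 1) * (b * p ^ (k - j) * g) := by
    rw [← Nat.add_sub_cancel' (Nat.lt_succ_iff.1 hj), pow_add, Nat.add_sub_cancel_left]
    rw [Nat.add_sub_cancel' (Nat.lt_succ_iff.1 hj), hab]
    ring
  rw [this, map_add, hf, hℓ.1 _ (dvd_mul_right _ _), add_zero]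

/-- The quotient is a Frobenius algebra: `c ↦ ℓ₀ (c * ·)` is injective into the dual, hence
bijective by dimension. If `p ∣ c`, then `ℓ` would vanish on `p ^ k * g`. -/
theorem IsPrimaryFunctional.exists_eq_mul {p : K[X]} (hp : Irreducible p) (hm : p.Monic) {k : ℕ}
    {ℓ₀ ℓ : K[X] →ₗ[K] K} (hℓ₀ : IsPrimaryFunctional p k ℓ₀) (hℓ : IsPrimaryFunctional p k ℓ) :
    ∃ c, ¬ p ∣ c ∧ ∀ f, ℓ f = ℓ₀ (c * f) := by
  have hP : (p ^ (k + 1)).Monic := hm.pow _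
  have key : ∀ {l : K[X] →ₗ[K] K}, IsPrimaryFunctional p k l → ∀ f,
      (l ∘ₗ AdjoinRoot.modByMonicHom hP) (AdjoinRoot.mk _ f) = l f := by
    intro l hl f
    rw [LinearMap.comp_apply, AdjoinRoot.modByMonicHom_mk]
    conv_rhs => rw [← modByMonic_add_div f (p ^ (k + 1))]
    rw [map_add, hl.1 _ (dvd_mul_right _ _), add_zero]
  let Ψ := (LinearMap.mul K (AdjoinRoot (p ^ (k + 1)))).compr₂
    (ℓ₀ ∘ₗ AdjoinRoot.modByMonicHom hP)
  have hΨ : ∀ c f, Ψ (AdjoinRoot.mk _ c) (AdjoinRoot.mk _ f) = ℓ₀ (c * f) := by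
    intro c f
    rw [← key hℓ₀, map_mul]
    rfl
  have hinj : Function.Injective Ψ := by
    rw [injective_iff_map_eq_zero]
    intro x hx
    obtain ⟨c, rfl⟩ := AdjoinRoot.mk_surjective x
    refine AdjoinRoot.mk_eq_zero.2 (hℓ₀.dvd_of_forall_mul_eq_zero hp fun f => ?_)
    rw [← hΨ, hx]; rfl
  have := (AdjoinRoot.powerBasis hP.ne_zero).finite
  have hsurj : Function.Surjective Ψ :=
    (LinearMap.injective_iff_surjective_of_finrank_eq_finrank
      (Subspace.dual_finrank_eq (K := K) (V := AdjoinRoot (p ^ (k + 1)))).symm).1 hinj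
  obtain ⟨x, hx⟩ := hsurj (ℓ ∘ₗ AdjoinRoot.modByMonicHom hP)
  obtain ⟨c, rfl⟩ := AdjoinRoot.mk_surjective x
  have hc : ∀ f, ℓ f = ℓ₀ (c * f) := fun f => by rw [← hΨ, hx, key hℓ]
  refine ⟨c, fun hpc => ?_, hc⟩
  obtain ⟨g, hg⟩ := hℓ.2
  apply hg
  rw [hc, hℓ₀.1]
  rw [pow_succ', ← mul_assoc]
  exact (mul_dvd_mul_right hpc _).mul_right _

/-- Hensel lifting: the derivative `2 * c * e` at an approximate root `e` is a unit modulo `p`,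
because `2 ≠ 0` and `p ∤ t`. -/
theorem exists_sq_congruent_mod_pow (h2 : (2 : K) ≠ 0) {p c d t : K[X]} (hp : Irreducible p)
    (ht : ¬ p ∣ t) (h : p ∣ c * d ^ 2 - t) (k : ℕ) :
    ∃ d', p ^ (k + 1) ∣ c * d' ^ 2 - t := by
  induction k with
  | zero => exact ⟨d, by simpa using h⟩
  | succ k ih =>
    obtain ⟨e, a, ha⟩ := ih
    have hce : ¬ p ∣ 2 * c * e := by
      intro hpe
      have h3 : p ∣ c * e := by
        rw [mul_assoc, show (2 : K[X]) = C 2 from rfl] at hpe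
        exact ((hp.prime.dvd_mul).1 hpe).resolve_left fun h' =>
          hp.not_isUnit (isUnit_of_dvd_unit h' (isUnit_C.2 (isUnit_iff_ne_zero.2 h2)))
      apply ht
      have : t = c * e * e - p * (p ^ k * a) := by
        linear_combination -ha
      rw [this]
      exact dvd_sub (h3.mul_right _) (dvd_mul_right _ _)
    obtain ⟨u, v, huv⟩ := (hp.coprime_iff_not_dvd).2 hce
    -- Newton step: `v` inverts `2 * c * e` modulo `p`, and `p ^ (k + 1) * a` is the current error.
    refine ⟨e - p ^ (k + 1) * (v * a), u * a + c * p ^ k * (v * a) ^ 2, ?_⟩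
    linear_combination ha - p ^ (k + 1) * a * huv

/-- Up to multiplication by squares there are finitely many primary functionals. -/
theorem PropertyFE.finitely_many_primary_functionals (hK : PropertyFE K) {p : K[X]}
    (hp : Irreducible p) (hm : p.Monic) (k : ℕ) :
    ∃ Λ : Set (K[X] →ₗ[K] K), Λ.Finite ∧ (∀ ℓ ∈ Λ, IsPrimaryFunctional p k ℓ) ∧
      ∀ ℓ, IsPrimaryFunctional p k ℓ → ∃ u, ℓ ∘ₗ LinearMap.mulLeft K (u ^ 2) ∈ Λ := by
  by_cases hne : ∃ ℓ₀ : K[X] →ₗ[K] K, IsPrimaryFunctional p k ℓ₀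
  · obtain ⟨ℓ₀, hℓ₀⟩ := hne
    obtain ⟨T, hT, hTp, hTc⟩ := hK.finitely_many_square_classes hp
    refine ⟨(fun t => ℓ₀ ∘ₗ LinearMap.mulLeft K t) '' T, hT.image _, ?_, ?_⟩
    · rintro _ ⟨t, ht, rfl⟩
      refine ⟨fun f hf => hℓ₀.1 _ (hf.mul_left t), ?_⟩
      by_contra! h0
      apply hTp t ht
      have h1 : p ^ (k + 1) ∣ t * p ^ k :=
        hℓ₀.dvd_of_forall_mul_eq_zero hp fun g => by rw [mul_assoc]; exact h0 g
      rw [pow_succ'] at h1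
      exact (mul_dvd_mul_iff_right (pow_ne_zero k hp.ne_zero)).1 h1
    · intro ℓ hℓ
      obtain ⟨c, hpc, hc⟩ := hℓ₀.exists_eq_mul hp hm hℓ
      obtain ⟨t, ht, d, hd⟩ := hTc c hpc
      obtain ⟨u, hu⟩ := exists_sq_congruent_mod_pow hK.two_ne_zero hp (hTp t ht) hd k
      refine ⟨u, t, ht, LinearMap.ext fun f => ?_⟩
      simp only [LinearMap.comp_apply, LinearMap.mulLeft_apply]
      rw [hc, ← sub_eq_zero, ← map_sub]
      refine hℓ₀.1 _ ?_
      rw [← neg_sub, dvd_neg, ← mul_assoc, ← sub_mul]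
      exact hu.mul_right _
  · exact ⟨∅, Set.finite_empty, by simp, fun ℓ hℓ => absurd ⟨ℓ, hℓ⟩ hne⟩

end Functionals

/-! ### Self-adjoint endomorphisms and primary vectors -/

section Hermitian

variable {K F V : Type*} [Field K] [Field F] [Algebra K F] [AddCommGroup V] [Module F V]

/-- `K` is the fixed field of `σ`, and `s` is a nonzero element with `σ s = - s`. -/
structure IsSkewGenerator (K : Type*) {F : Type*} [Field K] [Field F] [Algebra K F]
    (σ : F ≃+* F) (s : F) : Prop where
  map_algebraMap : ∀ k : K, σ (algebraMap K F k) = algebraMap K F k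
  exists_of_fixed : ∀ a : F, σ a = a → ∃ k : K, algebraMap K F k = a
  involutive : ∀ a : F, σ (σ a) = a
  map_eq_neg : σ s = -s
  ne_zero : s ≠ 0
  two_ne_zero : (2 : F) ≠ 0

variable {σ : F ≃+* F} {s : F}

theorem IsSkewGenerator.exists_eq_add_mul (hs : IsSkewGenerator K σ s) (a : F) :
    ∃ k l : K, a = algebraMap K F k + s * algebraMap K F l := by
  have h2 := hs.two_ne_zero
  have h0 := hs.ne_zero
  have h2' : σ 2 = 2 := map_ofNat σ 2
  obtain ⟨k, hk⟩ := hs.exists_of_fixed ((a + σ a) / 2) (by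
    rw [map_div₀, map_add, hs.involutive, h2', add_comm])
  obtain ⟨l, hl⟩ := hs.exists_of_fixed ((a - σ a) / (2 * s)) (by
    rw [map_div₀, map_sub, hs.involutive, map_mul, h2', hs.map_eq_neg, mul_neg, div_neg,
      ← neg_div, neg_sub])
  refine ⟨k, l, ?_⟩
  rw [hk, hl]
  field_simp
  ring

theorem IsSkewGenerator.eq_zero_of_add_mul_eq_zero (hs : IsSkewGenerator K σ s) {k l : K}
    (h : algebraMap K F k + s * algebraMap K F l = 0) : k = 0 ∧ l = 0 := by
  have h' := congrArg σ h
  rw [map_add, map_mul, hs.map_algebraMap, hs.map_algebraMap, hs.map_eq_neg, map_zero] at h'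
  have hk : 2 * algebraMap K F k = 0 := by linear_combination h + h'
  have hk : algebraMap K F k = 0 := (mul_eq_zero.1 hk).resolve_left hs.two_ne_zero
  rw [hk, zero_add] at h
  exact ⟨(map_eq_zero _).1 hk, (map_eq_zero _).1 ((mul_eq_zero.1 h).resolve_left hs.ne_zero)⟩

variable {B : V →ₗ[F] V →ₛₗ[(σ : F →+* F)] F}

/-- The endomorphism `h` is self-adjoint with respect to the form `B`. -/
def IsSelfAdjointFor (B : V →ₗ[F] V →ₛₗ[(σ : F →+* F)] F) (h : Module.End F V) : Prop :=
  ∀ u v, B (h u) v = B u (h v)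

theorem IsSelfAdjointFor.pow {h : Module.End F V} (hh : IsSelfAdjointFor B h) (n : ℕ) :
    IsSelfAdjointFor B (h ^ n) := by
  induction n with
  | zero => intro u v; rfl
  | succ n ih =>
    intro u v
    rw [pow_succ, Module.End.mul_apply, ih, hh, ← Module.End.mul_apply, ← pow_succ', pow_succ]

/-- If the form `B (h u) w` is nonzero on `W`, then it takes a nonzero value on the diagonal. -/
theorem exists_form_self_ne_zero (hs : IsSkewGenerator K σ s)
    {h : Module.End F V} {W : Submodule F V} {u w : V}
    (hu : u ∈ W) (hw : w ∈ W) (huw : B (h u) w ≠ 0) : ∃ v ∈ W, B (h v) v ≠ 0 := by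
  by_contra! H
  have key : ∀ x ∈ W, ∀ y ∈ W, B (h x) y + B (h y) x = 0 := by
    intro x hx y hy
    have := H (x + y) (W.add_mem hx hy)
    simpa [H x hx, H y hy, add_comm] using this
  have h1 := key u hu w hw
  -- Scaling `u` by the skew element `s` reverses the relative sign of the two terms, so they vanish
  -- separately.
  have h2 := key (s • u) (W.smul_mem s hu) w hw
  simp only [map_smul, LinearMap.smul_apply, LinearMap.map_smulₛₗ, smul_eq_mul,
    RingEquiv.coe_toRingHom, hs.map_eq_neg] at h2
  apply huw
  have h3 : (2 * s) * B (h u) w = 0 := by linear_combination s * h1 + h2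
  exact (mul_eq_zero.1 h3).resolve_left (mul_ne_zero hs.two_ne_zero hs.ne_zero)

variable [Module K V] [IsScalarTower K F V]

theorem form_smul_left (k : K) (u v : V) : B (k • u) v = algebraMap K F k * B u v := by
  rw [← algebraMap_smul F k u, map_smul, LinearMap.smul_apply, smul_eq_mul]

theorem IsSkewGenerator.form_smul_right (hs : IsSkewGenerator K σ s) (k : K) (u v : V) :
    B u (k • v) = algebraMap K F k * B u v := by
  rw [← algebraMap_smul F k v, LinearMap.map_smulₛₗ, smul_eq_mul, RingEquiv.coe_toRingHom,
    hs.map_algebraMap]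

theorem IsSelfAdjointFor.aeval (hs : IsSkewGenerator K σ s) {h : Module.End F V}
    (hh : IsSelfAdjointFor B h) (f : K[X]) : IsSelfAdjointFor B (aeval h f) := by
  induction f using Polynomial.induction_on' with
  | add f g hf hg =>
    intro u v
    simp only [map_add, LinearMap.add_apply, hf u v, hg u v]
  | monomial n a =>
    intro u v
    simp only [aeval_monomial, Module.End.mul_apply, Module.algebraMap_end_apply]
    rw [form_smul_left, hs.form_smul_right, hh.pow n]

/-- Self-adjointness and hermitian symmetry make `B (f(h) v) v` fixed by `σ`, so it lies in `K`. -/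
theorem exists_functional (hs : IsSkewGenerator K σ s) (hB : IsHermitianForm σ B)
    {h : Module.End F V} (hh : IsSelfAdjointFor B h) (v : V) :
    ∃ ℓ : K[X] →ₗ[K] K, ∀ f, algebraMap K F (ℓ f) = B (aeval h f v) v := by
  have H : ∀ f : K[X], ∃ k : K, algebraMap K F k = B (aeval h f v) v := fun f =>
    hs.exists_of_fixed _ (by rw [← hB, hh.aeval hs f])
  choose ℓ hℓ using H
  refine ⟨⟨⟨ℓ, fun f g => ?_⟩, fun k f => ?_⟩, hℓ⟩
  · apply (algebraMap K F).injective
    simp [hℓ]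
  · apply (algebraMap K F).injective
    simp [hℓ, Algebra.smul_def]

/-- The form `B` is nondegenerate on the subspace `W`. -/
def NondegenerateOn (B : V →ₗ[F] V →ₛₗ[(σ : F →+* F)] F) (W : Submodule F V) : Prop :=
  ∀ w ∈ W, (∀ w' ∈ W, B w w' = 0) → w = 0

theorem aeval_mem {h : Module.End F V} {W : Submodule F V} (hW : ∀ w ∈ W, h w ∈ W) (f : K[X])
    {w : V} (hw : w ∈ W) : aeval h f w ∈ W := by
  induction f using Polynomial.induction_on' with
  | add f g hf hg => rw [map_add]; exact W.add_mem hf hg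
  | monomial n a =>
    have hpow : ∀ n : ℕ, (h ^ n) w ∈ W := by
      intro n
      induction n with
      | zero => exact hw
      | succ n ih => rw [pow_succ']; exact hW _ ih
    simp only [aeval_monomial, Module.End.mul_apply, Module.algebraMap_end_apply]
    rw [← algebraMap_smul F a]
    exact W.smul_mem _ (hpow n)

/-- Let `μ = p ^ (k + 1) * q`, with `p ∤ q`, generate the annihilator of `W`. Then `p ^ k * q ^ 2`
does not kill `W`, so polarization gives `v` with `B (p ^ k q ^ 2 (h) v) v ≠ 0`. The vector `q(h) v`
is as required, one factor `q(h)` moving across the form. -/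
theorem exists_primary_vector (hs : IsSkewGenerator K σ s)
    {h : Module.End F V} (hh : IsSelfAdjointFor B h) {m : K[X]} (hm0 : m ≠ 0)
    (hm : aeval h m = 0) {W : Submodule F V} (hW : ∀ w ∈ W, h w ∈ W)
    (hnd : NondegenerateOn B W) (hne : W ≠ ⊥) :
    ∃ (p : K[X]) (k : ℕ), p.Monic ∧ Irreducible p ∧ p ^ (k + 1) ∣ m ∧ ∃ v ∈ W,
      aeval h (p ^ (k + 1)) v = 0 ∧ B (aeval h (p ^ k) v) v ≠ 0 := by
  let I : Ideal K[X] :=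
    { carrier := {f | ∀ w ∈ W, aeval h f w = 0}
      add_mem' := fun {f g} hf hg w hw => by
        rw [map_add, LinearMap.add_apply, hf w hw, hg w hw, add_zero]
      zero_mem' := fun w _ => by simp
      smul_mem' := fun c f hf w hw => by
        rw [smul_eq_mul, map_mul, Module.End.mul_apply, hf w hw, map_zero] }
  have hI : ∀ f, f ∈ I ↔ ∀ w ∈ W, aeval h f w = 0 := fun f => Iff.rfl
  obtain ⟨μ, hμ⟩ := IsPrincipalIdealRing.principal I
  have hμI : ∀ f, f ∈ I ↔ μ ∣ f := fun f => by
    rw [hμ]; exact Ideal.mem_span_singleton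
  have hμm : μ ∣ m := (hμI m).1 fun w _ => by rw [hm]; rfl
  have hμ0 : μ ≠ 0 := ne_zero_of_dvd_ne_zero hm0 hμm
  have hunit : ¬ IsUnit μ := fun hu => hne <| by
    rw [eq_bot_iff]
    intro w hw
    have := (hI 1).1 ((hμI 1).2 hu.dvd) w hw
    simpa using this
  obtain ⟨p, hpm, hp, hpd⟩ := exists_monic_irreducible_factor μ hunit
  obtain ⟨q, h1, h2⟩ :=
    (FiniteMultiplicity.of_prime_left hp.prime hμ0).exists_eq_pow_mul_and_not_dvd
  obtain ⟨k, hk⟩ : ∃ k, multiplicity p μ = k + 1 := by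
    refine Nat.exists_eq_succ_of_ne_zero fun h0 => h2 ?_
    rwa [h1, h0, pow_zero, one_mul] at hpd
  rw [hk] at h1
  have hnot : p ^ k * q ^ 2 ∉ I := by
    rw [hμI, h1, pow_succ, mul_assoc, mul_dvd_mul_iff_left (pow_ne_zero k hp.ne_zero)]
    intro hpq
    exact h2 (hp.prime.dvd_of_dvd_pow ((dvd_mul_right p q).trans hpq))
  rw [hI] at hnot
  push Not at hnot
  obtain ⟨u, hu, hu0⟩ := hnot
  obtain ⟨w, hw, huw⟩ : ∃ w ∈ W, B (aeval h (p ^ k * q ^ 2) u) w ≠ 0 := by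
    by_contra! H
    exact hu0 (hnd _ (aeval_mem hW _ hu) H)
  obtain ⟨v, hv, hvv⟩ := exists_form_self_ne_zero hs hu hw huw
  refine ⟨p, k, hpm, hp, (h1 ▸ dvd_mul_right _ _ : p ^ (k + 1) ∣ μ).trans hμm,
    aeval h q v, aeval_mem hW _ hv, ?_, ?_⟩
  · rw [← Module.End.mul_apply, ← map_mul, ← h1]
    exact (hI μ).1 ((hμI μ).2 dvd_rfl) v hv
  · rw [← hh.aeval hs q, ← Module.End.mul_apply, ← Module.End.mul_apply, ← map_mul, ← map_mul]
    convert hvv using 5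
    ring

/-- The subspace generated by `v` under `h`. -/
def cyclicSubspace (h : Module.End F V) (v : V) : Submodule F V :=
  Submodule.span F (Set.range fun a : ℕ => (h ^ a) v)

theorem mem_cyclicSubspace_self (h : Module.End F V) (v : V) : v ∈ cyclicSubspace h v :=
  Submodule.subset_span ⟨0, rfl⟩

theorem cyclicSubspace_stable (h : Module.End F V) (v : V) :
    ∀ w ∈ cyclicSubspace h v, h w ∈ cyclicSubspace h v := by
  intro w hw
  have : (cyclicSubspace h v) ≤ (cyclicSubspace h v).comap h := by
    refine Submodule.span_le.2 ?_
    rintro _ ⟨a, rfl⟩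
    exact Submodule.subset_span ⟨a + 1, by simp [pow_succ']⟩
  exact this hw

theorem cyclicSubspace_le {h : Module.End F V} {W : Submodule F V} (hW : ∀ w ∈ W, h w ∈ W) {v : V}
    (hv : v ∈ W) : cyclicSubspace h v ≤ W := by
  refine Submodule.span_le.2 ?_
  rintro _ ⟨a, rfl⟩
  induction a with
  | zero => exact hv
  | succ n ih => simp only [pow_succ']; exact hW _ ih

theorem exists_aeval_of_mem_cyclicSubspace (hs : IsSkewGenerator K σ s) {h : Module.End F V}
    {v w : V} (hw : w ∈ cyclicSubspace h v) :
    ∃ f g : K[X], w = aeval h f v + s • aeval h g v := by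
  induction hw using Submodule.span_induction with
  | mem x hx =>
    obtain ⟨a, rfl⟩ := hx
    exact ⟨X ^ a, 0, by simp⟩
  | zero => exact ⟨0, 0, by simp⟩
  | add x y _ _ hx hy =>
    obtain ⟨f, g, rfl⟩ := hx
    obtain ⟨f', g', rfl⟩ := hy
    refine ⟨f + f', g + g', ?_⟩
    simp only [map_add, LinearMap.add_apply, smul_add]
    abel
  | smul a x _ hx =>
    obtain ⟨f, g, rfl⟩ := hx
    obtain ⟨k, l, rfl⟩ := hs.exists_eq_add_mul (K := K) a
    -- Since `s ^ 2` lies in `K`, multiplication by `k + s * l` preserves the shape `f(h) v + s •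
    -- g(h) v`.
    obtain ⟨t, ht⟩ := hs.exists_of_fixed (s * s) (by rw [map_mul, hs.map_eq_neg, neg_mul_neg])
    refine ⟨k • f + (t * l) • g, l • f + k • g, ?_⟩
    simp only [map_add, LinearMap.add_apply, map_smul, LinearMap.smul_apply]
    simp only [← algebraMap_smul F k, ← algebraMap_smul F l, ← algebraMap_smul F (t * l),
      map_mul, ht, smul_add, smul_smul, add_smul]
    module

theorem nondegenerateOn_cyclicSubspace (hs : IsSkewGenerator K σ s)
    {h : Module.End F V} (hh : IsSelfAdjointFor B h) {v : V} {ℓ : K[X] →ₗ[K] K}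
    (hℓ : ∀ f, algebraMap K F (ℓ f) = B (aeval h f v) v) {p : K[X]} (hp : Irreducible p) {k : ℕ}
    (hprim : IsPrimaryFunctional p k ℓ) (hv : aeval h (p ^ (k + 1)) v = 0) :
    NondegenerateOn B (cyclicSubspace h v) := by
  intro w hw hw0
  obtain ⟨f, g, rfl⟩ := exists_aeval_of_mem_cyclicSubspace (K := K) hs hw
  have key : ∀ r, ℓ (f * r) = 0 ∧ ℓ (g * r) = 0 := by
    intro r
    apply hs.eq_zero_of_add_mul_eq_zero
    have := hw0 (aeval h r v)
      (aeval_mem (cyclicSubspace_stable h v) r (mem_cyclicSubspace_self h v))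
    rw [map_add, LinearMap.add_apply, map_smul, LinearMap.smul_apply, smul_eq_mul,
      ← hh.aeval hs r, ← hh.aeval hs r, ← Module.End.mul_apply, ← Module.End.mul_apply,
      ← map_mul, ← map_mul, ← hℓ, ← hℓ, mul_comm r, mul_comm r] at this
    exact this
  have hdvd : ∀ f, p ^ (k + 1) ∣ f → aeval h f v = 0 := by
    rintro _ ⟨c, rfl⟩
    rw [mul_comm, map_mul, Module.End.mul_apply, hv, map_zero]
  rw [hdvd f (hprim.dvd_of_forall_mul_eq_zero hp fun r => (key r).1),
    hdvd g (hprim.dvd_of_forall_mul_eq_zero hp fun r => (key r).2)]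
  simp

/-- Only finitely many prime powers divide `m`, each with finitely many normalized functionals.
Replacing `v` by `u(h) v` turns `ℓ` into `ℓ (u ^ 2 * ·)`, which normalizes it. -/
theorem PropertyFE.exists_normalized_vector (hK : PropertyFE K) (hs : IsSkewGenerator K σ s)
    (hB : IsHermitianForm σ B) {m : K[X]} (hm0 : m ≠ 0) :
    ∃ Λ : Set (K[X] →ₗ[K] K), Λ.Finite ∧ ∀ h : Module.End F V, IsSelfAdjointFor B h →
      aeval h m = 0 → ∀ W : Submodule F V, (∀ w ∈ W, h w ∈ W) → NondegenerateOn B W → W ≠ ⊥ →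
      ∃ v ∈ W, v ≠ 0 ∧ NondegenerateOn B (cyclicSubspace h v) ∧
        ∃ ℓ ∈ Λ, ∀ f, algebraMap K F (ℓ f) = B (aeval h f v) v := by
  classical
  have H : ∀ (p : K[X]) (k : ℕ), ∃ Λ : Set (K[X] →ₗ[K] K), Λ.Finite ∧
      (Irreducible p → p.Monic → (∀ ℓ ∈ Λ, IsPrimaryFunctional p k ℓ) ∧
      ∀ ℓ, IsPrimaryFunctional p k ℓ → ∃ u, ℓ ∘ₗ LinearMap.mulLeft K (u ^ 2) ∈ Λ) := by
    intro p k
    by_cases hp : Irreducible p ∧ p.Monic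
    · obtain ⟨Λ, h1, h2⟩ := hK.finitely_many_primary_functionals hp.1 hp.2 k
      exact ⟨Λ, h1, fun _ _ => h2⟩
    · exact ⟨∅, Set.finite_empty, fun h1 h2 => absurd ⟨h1, h2⟩ hp⟩
  choose Λ hΛ hΛp using H
  let P := (UniqueFactorizationMonoid.normalizedFactors m).toFinset
  refine ⟨⋃ p ∈ P, ⋃ k ∈ Finset.range (m.natDegree + 1), Λ p k,
    P.finite_toSet.biUnion fun p _ => (Finset.finite_toSet _).biUnion fun k _ => hΛ p k, ?_⟩
  intro h hh hm W hW hnd hne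
  obtain ⟨p, k, hpm, hp, hpk, v, hv, hv0, hvv⟩ :=
    exists_primary_vector hs hh hm0 hm hW hnd hne
  obtain ⟨ℓ, hℓ⟩ := exists_functional hs hB hh v
  have hprim : IsPrimaryFunctional p k ℓ := by
    refine ⟨?_, 1, ?_⟩
    · rintro _ ⟨c, rfl⟩
      apply (algebraMap K F).injective
      rw [hℓ, mul_comm, map_mul, Module.End.mul_apply, hv0]
      simp
    · intro h0
      rw [mul_one] at h0
      rw [← hℓ, h0, map_zero] at hvv
      exact hvv rfl
  obtain ⟨hΛ1, hΛ2⟩ := hΛp p k hp hpm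
  obtain ⟨u, hu⟩ := hΛ2 ℓ hprim
  have hℓ' : ∀ f, algebraMap K F ((ℓ ∘ₗ LinearMap.mulLeft K (u ^ 2)) f) =
      B (aeval h f (aeval h u v)) (aeval h u v) := by
    intro f
    rw [LinearMap.comp_apply, LinearMap.mulLeft_apply, hℓ, ← hh.aeval hs u,
      ← Module.End.mul_apply, ← Module.End.mul_apply, ← map_mul, ← map_mul,
      show u ^ 2 * f = u * (f * u) by ring, mul_assoc]
  have hv0' : aeval h (p ^ (k + 1)) (aeval h u v) = 0 := by
    rw [← Module.End.mul_apply, ← map_mul, mul_comm, map_mul, Module.End.mul_apply, hv0, map_zero]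
  refine ⟨aeval h u v, aeval_mem hW _ hv, fun h0 => ?_,
    nondegenerateOn_cyclicSubspace hs hh hℓ' hp (hΛ1 _ hu) hv0', _, ?_, hℓ'⟩
  · obtain ⟨g, hg⟩ := (hΛ1 _ hu).2
    apply hg
    apply (algebraMap K F).injective
    rw [hℓ', h0]
    simp
  · have hpP : p ∈ P := by
      rw [Multiset.mem_toFinset, UniqueFactorizationMonoid.mem_normalizedFactors_iff' hm0]
      exact ⟨hp, hpm.normalize_eq_self, (dvd_pow_self p (Nat.succ_ne_zero k)).trans hpk⟩
    have hkm : k ∈ Finset.range (m.natDegree + 1) := by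
      have h1 := natDegree_le_of_dvd hpk hm0
      rw [natDegree_pow] at h1
      have h2 := hp.natDegree_pos
      rw [Finset.mem_range]
      nlinarith
    exact Set.mem_biUnion hpP (Set.mem_biUnion hkm hu)

end Hermitian

/-! ### Orthogonal decomposition and classification up to isometry -/

section Decomposition

variable {K F V : Type*} [Field K] [Field F] [Algebra K F] [AddCommGroup V] [Module F V]
  {σ : F ≃+* F} {s : F} {B : V →ₗ[F] V →ₛₗ[(σ : F →+* F)] F}

/-- The left orthogonal of a subspace. -/
def leftOrthogonal (B : V →ₗ[F] V →ₛₗ[(σ : F →+* F)] F) (C : Submodule F V) : Submodule F V where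
  carrier := {w | ∀ c ∈ C, B w c = 0}
  add_mem' := fun {x y} hx hy c hc => by
    rw [map_add, LinearMap.add_apply, hx c hc, hy c hc, add_zero]
  zero_mem' := fun c _ => by simp
  smul_mem' := fun a x hx c hc => by
    rw [map_smul, LinearMap.smul_apply, hx c hc, smul_zero]

/-- Pairing with a basis of `C` is injective on `C`, hence bijective by dimension, so some element
of `C` pairs with `C` as `w` does. -/
theorem NondegenerateOn.exists_sub_mem_leftOrthogonal [FiniteDimensional F V]
    {C : Submodule F V} (hC : NondegenerateOn B C) (w : V) :
    ∃ c ∈ C, w - c ∈ leftOrthogonal B C := by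
  let b := Module.finBasis F C
  let Φ : V →ₗ[F] (Fin (Module.finrank F C) → F) := LinearMap.pi fun i => B.flip (b i)
  have hΦ : ∀ w i, Φ w i = B w (b i) := fun _ _ => rfl
  have horth : ∀ w, Φ w = 0 → w ∈ leftOrthogonal B C := by
    intro w hw c hc
    have key : ∀ x : C, B w x = 0 := by
      intro x
      have hx : x ∈ Submodule.span F (Set.range b) := by rw [b.span_eq]; trivial
      induction hx using Submodule.span_induction with
      | mem x hx =>
        obtain ⟨i, rfl⟩ := hx
        rw [← hΦ, hw]; rfl
      | zero => simp
      | add x y _ _ hx hy => simp [hx, hy]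
      | smul a x _ hx => simp [hx]
    exact key ⟨c, hc⟩
  have hinj : Function.Injective (Φ ∘ₗ C.subtype) := by
    rw [injective_iff_map_eq_zero]
    intro x hx
    exact Subtype.ext (hC x x.2 (horth x hx))
  have hsurj : Function.Surjective (Φ ∘ₗ C.subtype) :=
    (LinearMap.injective_iff_surjective_of_finrank_eq_finrank (by simp)).1 hinj
  obtain ⟨c, hc⟩ := hsurj (Φ w)
  refine ⟨c, c.2, horth _ ?_⟩
  rw [map_sub, ← hc]
  exact sub_self _

/-- Two families generating `V` under `h` and `h'`, with the same Gram matrices, are related by an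
isometry that intertwines `h` and `h'`. -/
theorem exists_isometry_of_gram_eq (hnd : B.Nondegenerate) {h h' : Module.End F V}
    (hh : IsSelfAdjointFor B h) (hh' : IsSelfAdjointFor B h') {ι : Type*} {v v' : ι → V}
    (hv : Submodule.span F (Set.range fun x : ι × ℕ => (h ^ x.2) (v x.1)) = ⊤)
    (hv' : Submodule.span F (Set.range fun x : ι × ℕ => (h' ^ x.2) (v' x.1)) = ⊤)
    (hgram : ∀ i j (a : ℕ), B ((h ^ a) (v i)) (v j) = B ((h' ^ a) (v' i)) (v' j)) :
    ∃ x ∈ unitaryGroupOf B, ∀ w, x (h w) = h' (x w) := by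
  let φ := Finsupp.linearCombination F fun x : ι × ℕ => (h ^ x.2) (v x.1)
  let φ' := Finsupp.linearCombination F fun x : ι × ℕ => (h' ^ x.2) (v' x.1)
  have hφ : Function.Surjective φ := by
    rw [← LinearMap.range_eq_top, Finsupp.range_linearCombination, hv]
  have hφ' : Function.Surjective φ' := by
    rw [← LinearMap.range_eq_top, Finsupp.range_linearCombination, hv']
  have hφs : ∀ x c, φ (Finsupp.single x c) = c • (h ^ x.2) (v x.1) := fun x c =>
    Finsupp.linearCombination_single F c x
  have hφs' : ∀ x c, φ' (Finsupp.single x c) = c • (h' ^ x.2) (v' x.1) := fun x c =>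
    Finsupp.linearCombination_single F c x
  have hform : ∀ f g, B (φ f) (φ g) = B (φ' f) (φ' g) := by
    intro f g
    induction f using Finsupp.induction_linear with
    | zero => simp
    | add f₁ f₂ h₁ h₂ => simp only [map_add, LinearMap.add_apply, h₁, h₂]
    | single x c =>
      induction g using Finsupp.induction_linear with
      | zero => simp
      | add f₁ f₂ h₁ h₂ => simp only [map_add, h₁, h₂]
      | single y d =>
        simp only [hφs, hφs', map_smul, LinearMap.smul_apply, LinearMap.map_smulₛₗ]
        rw [← hh.pow y.2, ← hh'.pow y.2, ← Module.End.mul_apply, ← Module.End.mul_apply,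
          ← pow_add, ← pow_add, hgram]
  -- Both kernels are the radical of the same form pulled back to the free space.
  have hzero : ∀ f, φ f = 0 ↔ φ' f = 0 := by
    intro f
    constructor
    · intro hf
      refine hnd.1 _ fun y => ?_
      obtain ⟨g, rfl⟩ := hφ' y
      rw [← hform, hf]; simp
    · intro hf
      refine hnd.1 _ fun y => ?_
      obtain ⟨g, rfl⟩ := hφ y
      rw [hform, hf]; simp
  have hker : LinearMap.ker φ = LinearMap.ker φ' := by
    ext f
    exact hzero f
  let x : V ≃ₗ[F] V := (φ.quotKerEquivOfSurjective hφ).symm ≪≫ₗ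
    Submodule.quotEquivOfEq _ _ hker ≪≫ₗ φ'.quotKerEquivOfSurjective hφ'
  have hx : ∀ f, x (φ f) = φ' f := by
    intro f
    have : (φ.quotKerEquivOfSurjective hφ).symm (φ f) = Submodule.Quotient.mk f := by
      rw [LinearEquiv.symm_apply_eq]; rfl
    simp only [x, LinearEquiv.trans_apply, this]
    rfl
  refine ⟨x, ?_, ?_⟩
  · intro u w
    obtain ⟨f, rfl⟩ := hφ u
    obtain ⟨g, rfl⟩ := hφ w
    rw [hx, hx, hform]
  · intro w
    obtain ⟨f, rfl⟩ := hφ w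
    rw [hx]
    induction f using Finsupp.induction_linear with
    | zero => simp
    | add f₁ f₂ h₁ h₂ => simp only [map_add, h₁, h₂]
    | single y c =>
      have h1 : h (φ (Finsupp.single y c)) = φ (Finsupp.single (y.1, y.2 + 1) c) := by
        rw [hφs, hφs, map_smul, pow_succ', Module.End.mul_apply]
      rw [h1, hx, hφs', hφs', map_smul, pow_succ', Module.End.mul_apply]

variable [Module K V] [IsScalarTower K F V]

/-- Split off a nondegenerate cyclic subspace; its orthogonal inside `W` is stable, nondegenerate
and strictly smaller. -/
theorem exists_orthogonal_family [FiniteDimensional F V] (hB : IsHermitianForm σ B)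
    {h : Module.End F V} (hh : IsSelfAdjointFor B h) {Λ : Set (K[X] →ₗ[K] K)}
    (hΛ : ∀ W : Submodule F V, (∀ w ∈ W, h w ∈ W) → NondegenerateOn B W → W ≠ ⊥ →
      ∃ v ∈ W, v ≠ 0 ∧ NondegenerateOn B (cyclicSubspace h v) ∧
        ∃ ℓ ∈ Λ, ∀ f, algebraMap K F (ℓ f) = B (aeval h f v) v) (n : ℕ) :
    ∀ W : Submodule F V, (∀ w ∈ W, h w ∈ W) → NondegenerateOn B W → Module.finrank F W ≤ n →
    ∃ r ≤ n, ∃ (v : Fin r → V) (L : Fin r → Λ),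
      Submodule.span F (Set.range fun x : Fin r × ℕ => (h ^ x.2) (v x.1)) = W ∧
      (∀ i j, i ≠ j → ∀ a : ℕ, B ((h ^ a) (v i)) (v j) = 0) ∧
      ∀ i f, algebraMap K F ((L i : K[X] →ₗ[K] K) f) = B (aeval h f (v i)) (v i) := by
  induction n with
  | zero =>
    intro W _ _ hW
    have : W = ⊥ := Submodule.finrank_eq_zero.1 (Nat.le_zero.1 hW)
    subst this
    exact ⟨0, le_rfl, Fin.elim0, Fin.elim0, by simp, fun i => i.elim0, fun i => i.elim0⟩
  | succ n ih =>
    intro W hW hnd hrank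
    by_cases hne : W = ⊥
    · subst hne
      exact ⟨0, Nat.zero_le _, Fin.elim0, Fin.elim0, by simp, fun i => i.elim0,
        fun i => i.elim0⟩
    obtain ⟨v, hvW, hv0, hC, ℓ, hℓΛ, hℓ⟩ := hΛ W hW hnd hne
    set C := cyclicSubspace h v with hCdef
    have hCW : C ≤ W := cyclicSubspace_le hW hvW
    let W' := W ⊓ leftOrthogonal B C
    have hsymm : ∀ {x y}, B x y = 0 → B y x = 0 := fun {x y} hxy => by rw [hB, hxy, map_zero]
    have hW' : ∀ w ∈ W', h w ∈ W' := by
      rintro w ⟨h1, h2⟩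
      refine ⟨hW w h1, fun c hc => ?_⟩
      rw [hh]
      exact h2 _ (cyclicSubspace_stable h v c hc)
    have hnd' : NondegenerateOn B W' := by
      rintro w ⟨h1, h2⟩ hw
      refine hnd w h1 fun u hu => ?_
      obtain ⟨c, hc, huc⟩ := hC.exists_sub_mem_leftOrthogonal u
      have h3 : u - c ∈ W' := ⟨W.sub_mem hu (hCW hc), huc⟩
      have h4 := hw _ h3
      rwa [map_sub, h2 c hc, sub_zero] at h4
    have hlt : Module.finrank F W' < Module.finrank F W := by
      refine Submodule.finrank_lt_finrank_of_lt (lt_of_le_of_ne inf_le_left fun heq => hv0 ?_)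
      have : v ∈ W' := heq ▸ hvW
      exact hC v (mem_cyclicSubspace_self h v) this.2
    obtain ⟨r, hr, v', L, hspan, horth, hL⟩ := ih W' hW' hnd' (by omega)
    have hv' : ∀ i a, (h ^ a) (v' i) ∈ W' := fun i a => by
      rw [← hspan]; exact Submodule.subset_span ⟨(i, a), rfl⟩
    have hCmem : ∀ a : ℕ, (h ^ a) v ∈ C := fun a => Submodule.subset_span ⟨a, rfl⟩
    refine ⟨r + 1, by omega, Fin.cons v v', Fin.cons ⟨ℓ, hℓΛ⟩ L, ?_, ?_, ?_⟩
    · apply le_antisymm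
      · refine Submodule.span_le.2 ?_
        rintro _ ⟨⟨i, a⟩, rfl⟩
        refine Fin.cases ?_ (fun i => ?_) i
        · exact hCW (hCmem a)
        · exact (hv' i a).1
      · intro w hw
        obtain ⟨c, hc, hwc⟩ := hC.exists_sub_mem_leftOrthogonal w
        have h3 : w - c ∈ W' := ⟨W.sub_mem hw (hCW hc), hwc⟩
        rw [← sub_add_cancel w c]
        refine Submodule.add_mem _ ?_ ?_
        · rw [← hspan] at h3
          refine Submodule.span_mono ?_ h3
          rintro _ ⟨⟨i, a⟩, rfl⟩
          exact ⟨(i.succ, a), rfl⟩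
        · refine Submodule.span_mono ?_ hc
          rintro _ ⟨a, rfl⟩
          exact ⟨(0, a), rfl⟩
    · intro i j
      refine Fin.cases ?_ (fun i => ?_) i <;> refine Fin.cases ?_ (fun j => ?_) j
      · intro hij; exact absurd rfl hij
      · intro _ a
        exact hsymm ((hv' j 0).2 _ (hCmem a))
      · intro _ a
        exact (hv' i a).2 _ (hCmem 0)
      · intro hij a
        exact horth i j (fun h => hij (congrArg Fin.succ h)) a
    · intro i
      refine Fin.cases ?_ (fun i => ?_) i
      · exact hℓ
      · exact hL i

/-- Up to isometry there are finitely many self-adjoint endomorphisms annihilated by a given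
polynomial. -/
theorem PropertyFE.finitely_many_selfAdjoint_classes [FiniteDimensional F V] (hK : PropertyFE K)
    (hs : IsSkewGenerator K σ s) (hB : IsHermitianForm σ B) (hnd : B.Nondegenerate) {m : K[X]}
    (hm0 : m ≠ 0) :
    FinitelyManyClasses {h : Module.End F V | IsSelfAdjointFor B h ∧ aeval h m = 0}
      (fun h h' => ∃ x ∈ unitaryGroupOf B, ∀ w, x (h w) = h' (x w)) := by
  obtain ⟨Λ, hΛfin, hΛ⟩ := hK.exists_normalized_vector hs hB hm0
  have := hΛfin.to_subtype
  -- The datum is the number of cyclic blocks with their functionals; it fixes all Gram entries.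
  refine FinitelyManyClasses.of_data
    (β := Σ r : Fin (Module.finrank F V + 1), (Fin r → Λ))
    (fun h b => IsSelfAdjointFor B h ∧ ∃ v : Fin b.1 → V,
      Submodule.span F (Set.range fun x : Fin b.1 × ℕ => (h ^ x.2) (v x.1)) = ⊤ ∧
      (∀ i j, i ≠ j → ∀ a : ℕ, B ((h ^ a) (v i)) (v j) = 0) ∧
      ∀ i f, algebraMap K F ((b.2 i : K[X] →ₗ[K] K) f) = B (aeval h f (v i)) (v i)) ?_ ?_
  · rintro h ⟨hh, hm⟩
    obtain ⟨r, hr, v, L, h1, h2, h3⟩ := exists_orthogonal_family hB hh (hΛ h hh hm)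
      (Module.finrank F V) ⊤ (fun _ _ => trivial)
      (fun w _ hw => hnd.1 w fun y => hw y trivial) (Submodule.finrank_le _)
    exact ⟨⟨⟨r, Nat.lt_succ_of_le hr⟩, L⟩, hh, v, h1, h2, h3⟩
  · rintro h h' ⟨r, L⟩ ⟨hh, v, h1, h2, h3⟩ ⟨hh', v', h1', h2', h3'⟩
    refine exists_isometry_of_gram_eq hnd hh hh' h1 h1' fun i j a => ?_
    by_cases hij : i = j
    · subst hij
      have e := (h3 i (X ^ a)).symm.trans (h3' i (X ^ a))
      simpa using e
    · rw [h2 i j hij a, h2' i j hij a]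

end Decomposition

/-! ### Cayley transform and passage to centralizers -/

section Cayley

variable {K F V : Type*} [Field K] [Field F] [Algebra K F] [AddCommGroup V] [Module F V]
  {σ : F ≃+* F} {s : F} {B : V →ₗ[F] V →ₛₗ[(σ : F →+* F)] F}

theorem IsSkewGenerator.sub_ne_zero (hs : IsSkewGenerator K σ s) (a : K) :
    algebraMap K F a - s ≠ 0 := by
  intro h
  have := hs.eq_zero_of_add_mul_eq_zero (k := a) (l := -1) (by
    rw [map_neg, map_one]; linear_combination h)
  simp at this

theorem IsSkewGenerator.add_ne_zero (hs : IsSkewGenerator K σ s) (a : K) :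
    algebraMap K F a + s ≠ 0 := by
  intro h
  have := hs.eq_zero_of_add_mul_eq_zero (k := a) (l := 1) (by
    rw [map_one]; linear_combination h)
  simp at this

/-- The Cayley transform: every isometry has the same commuting isometries as some self-adjoint
endomorphism. -/
theorem exists_selfAdjoint_commute_iff [FiniteDimensional F V] [Infinite K]
    (hs : IsSkewGenerator K σ s) {g : V ≃ₗ[F] V} (hg : g ∈ unitaryGroupOf B) :
    ∃ h : Module.End F V, IsSelfAdjointFor B h ∧
      ∀ x : V ≃ₗ[F] V, (∀ v, x (g v) = g (x v)) ↔ ∀ v, x (h v) = h (x v) := by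
  have h2 := hs.two_ne_zero
  have h0 := hs.ne_zero
  have hinj : Function.Injective fun a : K => (algebraMap K F a + s) / (algebraMap K F a - s) := by
    intro a b hab
    have hab : (algebraMap K F a + s) / (algebraMap K F a - s) =
      (algebraMap K F b + s) / (algebraMap K F b - s) := hab
    rw [div_eq_div_iff (hs.sub_ne_zero a) (hs.sub_ne_zero b)] at hab
    apply (algebraMap K F).injective
    have : (2 * s) * (algebraMap K F a - algebraMap K F b) = 0 := by linear_combination -hab
    exact sub_eq_zero.1 ((mul_eq_zero.1 this).resolve_left (mul_ne_zero h2 h0))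
  -- Infinitely many `a` compete with finitely many eigenvalues of `g`, so some `(a + s) / (a - s)`
  -- is not an eigenvalue; this makes `D` below invertible.
  obtain ⟨a, ha⟩ := ((Module.End.finite_hasEigenvalue (g : Module.End F V)).preimage
    hinj.injOn).infinite_compl.nonempty
  set α := algebraMap K F a + s with hα
  set β := algebraMap K F a - s with hβ
  have hα0 : α ≠ 0 := hs.add_ne_zero a
  have hβ0 : β ≠ 0 := hs.sub_ne_zero a
  have hσα : σ α = β := by rw [hα, map_add, hs.map_algebraMap, hs.map_eq_neg, ← sub_eq_add_neg]
  have hσβ : σ β = α := by rw [hβ, map_sub, hs.map_algebraMap, hs.map_eq_neg, sub_neg_eq_add]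
  let D : Module.End F V := α • LinearMap.id - β • (g : V →ₗ[F] V)
  have hD : ∀ v, D v = α • v - β • g v := fun _ => rfl
  have hDinj : Function.Injective D := by
    rw [injective_iff_map_eq_zero]
    intro v hv
    by_contra hv0
    apply ha
    refine Module.End.hasEigenvalue_of_hasEigenvector (x := v) ⟨?_, hv0⟩
    rw [Module.End.mem_eigenspace_iff]
    rw [hD, sub_eq_zero] at hv
    change g v = (α / β) • v
    rw [div_eq_inv_mul, mul_smul, hv, smul_smul, inv_mul_cancel₀ hβ0, one_smul]
  let e := LinearEquiv.ofInjectiveEndo D hDinj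
  have he : ∀ v, D (e.symm v) = v := fun v => e.apply_symm_apply v
  have he' : ∀ v, e.symm (D v) = v := fun v => e.symm_apply_apply v
  let N : Module.End F V := s • (α • LinearMap.id + β • (g : V →ₗ[F] V))
  have hN : ∀ v, N v = s • (α • v + β • g v) := fun _ => rfl
  let h : Module.End F V := N ∘ₗ e.symm
  have hhD : ∀ v, h (D v) = N v := fun v => congrArg N (he' v)
  have hDsurj : Function.Surjective D := fun v => ⟨_, he v⟩
  refine ⟨h, ?_, fun x => ⟨fun hx v => ?_, fun hx v => ?_⟩⟩
  · intro u v
    obtain ⟨u, rfl⟩ := hDsurj u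
    obtain ⟨v, rfl⟩ := hDsurj v
    rw [hhD, hhD, hN, hN, hD, hD]
    simp only [map_smul, map_add, map_sub, LinearMap.smul_apply, LinearMap.add_apply,
      LinearMap.sub_apply, LinearMap.map_smulₛₗ, smul_eq_mul, RingEquiv.coe_toRingHom, hσα, hσβ,
      hs.map_eq_neg, hg u v]
    ring
  · obtain ⟨v, rfl⟩ := hDsurj v
    have hxD : x (D v) = D (x v) := by rw [hD, hD, map_sub, map_smul, map_smul, hx]
    rw [hxD, hhD, hhD, hN, hN, map_smul, map_add, map_smul, map_smul, hx]
  -- The transform is undone by `h + s = 2 s α D⁻¹`: commuting with `h` gives commuting with `D`,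
  -- hence with `g`.
  · have h1 : ∀ w, h w + s • w = (2 * s * α) • e.symm w := by
      intro w
      obtain ⟨w, rfl⟩ := hDsurj w
      rw [hhD, he', hN, hD]
      module
    have hxe : ∀ w, x (e.symm w) = e.symm (x w) := by
      intro w
      have h3 : x (h w + s • w) = h (x w) + s • x w := by rw [map_add, hx, map_smul]
      rw [h1, h1, map_smul] at h3
      exact smul_right_injective V (mul_ne_zero (mul_ne_zero h2 h0) hα0) h3
    have hxD : x (D v) = D (x v) := by
      apply e.symm.injective
      rw [← hxe, he', he']
    rw [hD, hD, map_sub, map_smul, map_smul] at hxD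
    exact smul_right_injective V hβ0 (sub_right_injective hxD)

/-- Padding the minimal polynomial by a power of `X` gives one degree for all elements, so a single
finite list of polynomials serves. -/
theorem exists_monic_annihilating_of_finite {A : Type*} [Ring A] [Algebra K A] [Module.Finite K A]
    (x : A) : ∃ m : K[X], m.Monic ∧ m.natDegree = Module.finrank K A ∧ aeval x m = 0 := by
  have hx : IsIntegral K x := Algebra.IsIntegral.isIntegral x
  refine ⟨minpoly K x * X ^ (Module.finrank K A - (minpoly K x).natDegree),
    (minpoly.monic hx).mul (monic_X_pow _), ?_, by simp⟩
  rw [(minpoly.monic hx).natDegree_mul (monic_X_pow _), natDegree_X_pow,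
    Nat.add_sub_cancel' (minpoly.natDegree_le x)]

theorem IsSkewGenerator.module_finite (hs : IsSkewGenerator K σ s) : Module.Finite K F := by
  classical
  refine ⟨⟨{1, s}, ?_⟩⟩
  rw [eq_top_iff]
  intro a _
  obtain ⟨k, l, rfl⟩ := hs.exists_eq_add_mul (K := K) a
  rw [Finset.coe_pair, Submodule.mem_span_pair]
  exact ⟨k, l, by rw [Algebra.smul_def, Algebra.smul_def, mul_one, mul_comm s]⟩

variable [Module K V] [IsScalarTower K F V]

theorem commute_aeval {x : V ≃ₗ[F] V} {h : Module.End F V} (hx : ∀ v, x (h v) = h (x v))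
    (f : K[X]) (v : V) : x (aeval h f v) = aeval h f (x v) := by
  have h1 : Commute (x : Module.End F V) h := LinearMap.ext hx
  have h2 : Commute (x : Module.End F V) (aeval h f) := by
    induction f using Polynomial.induction_on' with
    | add f g hf hg => rw [map_add]; exact hf.add_right hg
    | monomial n a =>
      rw [aeval_monomial]
      exact (Algebra.commute_algebraMap_right a _).mul_right (h1.pow_right n)
  exact LinearMap.congr_fun h2.eq v

theorem zEquiv_of_intertwine {g g' : unitaryGroupOf B} {h h' : Module.End F V}
    (hg : ∀ x ∈ unitaryGroupOf B,
      (∀ v, x ((g : V ≃ₗ[F] V) v) = (g : V ≃ₗ[F] V) (x v)) ↔ ∀ v, x (h v) = h (x v))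
    (hg' : ∀ x ∈ unitaryGroupOf B,
      (∀ v, x ((g' : V ≃ₗ[F] V) v) = (g' : V ≃ₗ[F] V) (x v)) ↔ ∀ v, x (h' v) = h' (x v))
    {y : V ≃ₗ[F] V} (hy : y ∈ unitaryGroupOf B) (hyh : ∀ w, y (h w) = h' (y w)) :
    ZEquiv g g' := by
  have hcent : ∀ {g : unitaryGroupOf B} {h : Module.End F V}, (∀ x ∈ unitaryGroupOf B,
      (∀ v, x ((g : V ≃ₗ[F] V) v) = (g : V ≃ₗ[F] V) (x v)) ↔ ∀ v, x (h v) = h (x v)) →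
      ∀ x : unitaryGroupOf B, x ∈ Subgroup.centralizer {g} ↔
        ∀ v, (x : V ≃ₗ[F] V) (h v) = h ((x : V ≃ₗ[F] V) v) := by
    intro g h hg x
    rw [← hg x x.2, Subgroup.mem_centralizer_singleton_iff]
    constructor
    · intro hx v
      exact LinearEquiv.congr_fun (congrArg Subtype.val hx) v
    · intro hx
      exact Subtype.ext (LinearEquiv.ext hx)
  refine ⟨⟨y, hy⟩, ?_⟩
  ext x
  rw [Subgroup.mem_map_equiv, hcent hg', hcent hg]
  have hsymm : ∀ w, y⁻¹ (h' w) = h (y⁻¹ w) := fun w => by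
    apply y.injective
    rw [hyh]
    change y (y.symm _) = h' (y (y.symm _))
    rw [y.apply_symm_apply, y.apply_symm_apply]
  have hval : ∀ v, (((MulAut.conj (⟨y, hy⟩ : unitaryGroupOf B)).symm x : unitaryGroupOf B) :
      V ≃ₗ[F] V) v = y⁻¹ ((x : V ≃ₗ[F] V) (y v)) := fun v => rfl
  constructor
  · intro hx v
    rw [hval, hval, hyh, hx, hsymm]
  · intro hx v
    have := hx (y⁻¹ v)
    rw [hval, hval, hyh] at this
    have h1 : ∀ w, y (y⁻¹ w) = w := y.apply_symm_apply
    rw [h1] at this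
    have h3 := congrArg y this
    rw [hyh, h1, h1] at h3
    exact h3

theorem finite_zClass_of_skewGenerator [FiniteDimensional F V] [Infinite K] (hK : PropertyFE K)
    (hs : IsSkewGenerator K σ s) (hB : IsHermitianForm σ B) (hnd : B.Nondegenerate) :
    FinitelyManyClasses (Set.univ : Set (unitaryGroupOf B)) ZEquiv := by
  have := hs.module_finite
  have : Module.Finite K (Module.End F V) := Module.Finite.trans F _
  obtain ⟨T, hT, hTs, hTr⟩ :=
    (hK.finitely_many_monic_classes (Module.finrank K (Module.End F V))).exists_representatives
  have := hT.to_subtype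
  choose ι hι f hf using fun m : T =>
    hK.finitely_many_selfAdjoint_classes hs hB hnd (hTs m.2).1.ne_zero
  refine FinitelyManyClasses.of_data (β := Σ m : T, ι m) (fun g b => ∃ h : Module.End F V,
    (IsSelfAdjointFor B h ∧ aeval h (b.1 : K[X]) = 0) ∧ f b.1 h = b.2 ∧
    ∀ x ∈ unitaryGroupOf B,
      (∀ v, x ((g : V ≃ₗ[F] V) v) = (g : V ≃ₗ[F] V) (x v)) ↔ ∀ v, x (h v) = h (x v)) ?_ ?_
  · intro g _
    obtain ⟨h, hh, hgh⟩ := exists_selfAdjoint_commute_iff hs g.2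
    obtain ⟨m, hm, hmn, hmh⟩ := exists_monic_annihilating_of_finite (K := K) h
    obtain ⟨q, hq, r, r', h1, h2⟩ := hTr m ⟨hm, hmn⟩
    have hdvd : ∀ f, m ∣ f → aeval h f = 0 := by
      rintro _ ⟨c, rfl⟩
      rw [map_mul, hmh, zero_mul]
    have hback : aeval (aeval h r) r' = h := by
      have := hdvd _ h2
      rwa [map_sub, aeval_comp, aeval_X, sub_eq_zero] at this
    -- The new generator `r(h)` is annihilated by `q`; as `r'` recovers `h` from it, both have the
    -- same commutant.
    refine ⟨⟨⟨q, hq⟩, f ⟨q, hq⟩ (aeval h r)⟩, aeval h r, ⟨hh.aeval hs r, ?_⟩, rfl, ?_⟩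
    · rw [← aeval_comp]
      exact hdvd _ h1
    · intro x _
      rw [hgh x]
      refine ⟨fun hx => commute_aeval hx r, fun hx v => ?_⟩
      have := commute_aeval hx r' v
      rwa [hback] at this
  · rintro g g' ⟨m, i⟩ ⟨h, hm, hi, hg⟩ ⟨h', hm', hi', hg'⟩
    obtain ⟨y, hy, hyh⟩ := hf m h hm h' hm' (hi.trans hi'.symm)
    exact zEquiv_of_intertwine hg hg' hy hyh

end Cayley

/-! ### The main theorem -/

theorem isSkewGenerator_of_orderOf_eq_two {F : Type*} [Field F] {σ : F ≃+* F}
    (hσ : orderOf σ = 2) (h2 : (2 : fixedSubfield σ) ≠ 0) :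
    ∃ s, IsSkewGenerator (fixedSubfield σ) σ s := by
  have hinv : ∀ a, σ (σ a) = a := by
    intro a
    have := pow_orderOf_eq_one σ
    rw [hσ, sq] at this
    exact RingEquiv.congr_fun this a
  have hne : ∃ a, σ a ≠ a := by
    by_contra! H
    have : σ = 1 := RingEquiv.ext H
    rw [this, orderOf_one] at hσ
    norm_num at hσ
  obtain ⟨a, ha⟩ := hne
  refine ⟨a - σ a, fun k => k.2, fun b hb => ⟨⟨b, hb⟩, rfl⟩, hinv, ?_,
    fun h => ha (sub_eq_zero.1 h).symm, fun h => h2 (Subtype.ext h)⟩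
  rw [map_sub, hinv, neg_sub]

theorem mainTheorem1 {F V : Type*} [Field F] [AddCommGroup V] [Module F V]
    [FiniteDimensional F V] (σ : F ≃+* F) (hσ : orderOf σ = 2)
    (hFE : PropertyFE (fixedSubfield σ))
    (B : V →ₗ[F] V →ₛₗ[(σ : F →+* F)] F)
    (hB : IsHermitianForm σ B) (hnd : B.Nondegenerate) :
    Finite (ZClass (unitaryGroupOf B)) := by
  obtain ⟨s, hs⟩ := isSkewGenerator_of_orderOf_eq_two hσ hFE.two_ne_zero
  -- Over a finite field the Cayley parameter may not exist, but the group itself is finite.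
  rcases finite_or_infinite (fixedSubfield σ) with hfin | hinf
  · have := hs.module_finite
    have : Finite F := Module.finite_of_finite (fixedSubfield σ)
    have : Finite V := Module.finite_of_finite F
    have : Finite (V ≃ₗ[F] V) := Finite.of_injective (fun g => (g : V → V)) DFunLike.coe_injective
    exact Quotient.finite _
  · obtain ⟨ι, _, f, hf⟩ := finite_zClass_of_skewGenerator hFE hs hB hnd
    refine Finite.of_injective (fun c : ZClass (unitaryGroupOf B) => f (Quotient.out c)) ?_
    intro c c' hcc'
    exact Quotient.out_equiv_out.1 (hf _ trivial _ trivial hcc')
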